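/- Let $f:\mathbb R^n\to\mathbb R$ and $c=(c_1,\dots,c_p):\mathbb R^n\to\mathbb R^p$ be continuously differentiable, $A\in\mathbb R^{q\times n}$, $B\in\mathbb R^{q\times m}$, $b\in\mathbb R^q$, and consider the problem $$\min_{x,y} f(x)\quad\text{subject to}\quad c(x)=0,\ Ax+By=b .$$ Write $\nabla c(x)^{T}$ for the Jacobian matrix of $c$ at $x$, and $\|\cdot\|$ for the Euclidean norm. Let $(x^*,y^*,\mu^*,\lambda^*)\in\mathbb R^n\times\mathbb R^m\times\mathbb R^p\times\mathbb R^q$ be a KKT point of the problem, that is, $$\nabla f(x^*)+\nabla c(x^*)\mu^*+A^T\lambda^*=0,\quad B^T\lambda^*=0,\quad c(x^*)=0,\quad Ax^*+By^*=b .$$ Assume that $f$ and $c$ are twice continuously differentiable on a neighborhood of $x^*$, that the rows of $$C=\begin{bmatrix}\nabla c(x^*)^T&0\\A&B\end{bmatrix}$$ are linearly independent, and that $$z^T\begin{bmatrix}\nabla^2 f(x^*)+\sum_j\mu^*_j\nabla^2c_j(x^*)&0\\0&0\end{bmatrix}z>0\quad\text{for all } z\ne0 \text{ with } Cz=0.$$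 An ADMM run with penalty parameter $\rho>0$ (without a stopping test) consists of sequences $(x^{k+1},\mu^{k+1})_{k\ge0}$ and $(y^k,\lambda^k)_{k\ge0}$ with $B^T\lambda^0=0$ such that, for every $k\ge0$: $x^{k+1}$ is a local minimizer of $$\min_x\ f(x)+(\lambda^k)^T(Ax+By^k-b)+\tfrac{\rho}{2}\|Ax+By^k-b\|^2\quad\text{subject to}\quad c(x)=0,$$ and $(x^{k+1},\mu^{k+1})$ is a KKT point of this subproblem, that is, $c(x^{k+1})=0$ and $$\nabla f(x^{k+1})+\nabla c(x^{k+1})\mu^{k+1}+A^T\big(\lambda^k+\rho(Ax^{k+1}+By^k-b)\big)=0;$$ $y^{k+1}$ minimizes $y\mapsto(\lambda^k)^T(Ax^{k+1}+By-b)+\tfrac{\rho}{2}\|Ax^{k+1}+By-b\|^2$ over $\mathbb R^m$; and $\lambda^{k+1}=\lambda^k+\rho q^{k+1}$, where $q^{k+1}=Ax^{k+1}+By^{k+1}-b$. **Proposition.** There exist constants $\varepsilon>0$ and $\rho^*>0$, depending only on the problem and on $(x^*,y^*,\mu^*,\lambda^*)$, such that for every $\rho>\rho^*$ and every ADMM run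 with penalty parameter $\rho$: if $$\|(x^{k+1},y^{k+1},\mu^{k+1},\lambda^{k+1})-(x^*,y^*,\mu^*,\lambda^*)\|<\varepsilon\quad\text{for all sufficiently large }k,$$ then $$\rho\,\|B(y^k-y^{k+1})\|^2+\tfrac{\rho}{2}\|q^{k+1}\|^2\to0\quad\text{as }k\to\infty .$$ -/

import Mathlib

open Filter Topology

noncomputable section

namespace NonconvexADMM

/-- `ℝⁿ` with the Euclidean norm. -/
abbrev Vec (n : ℕ) := EuclideanSpace ℝ (Fin n)

/-- The matrix-vector product as a map between Euclidean spaces. -/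
def mulV {a b : ℕ} (M : Matrix (Fin a) (Fin b) ℝ) (v : Vec b) : Vec a :=
  WithLp.toLp 2 (M.mulVec v.ofLp)

/-- The Jacobian matrix of `c` at `x`: row `j` is the transposed gradient of the component `c_j`.
Its transpose is the matrix written `∇c(x)`. -/
def jacobian {n p : ℕ} (c : Vec n → Vec p) (x : Vec n) : Matrix (Fin p) (Fin n) ℝ :=
  Matrix.of fun j i => gradient (fun z => c z j) x i

/-- The Hessian matrix of `g` at `x`, with entries `∂ᵢ∂ⱼ g(x)`. -/
def hessian {n : ℕ} (g : Vec n → ℝ) (x : Vec n) : Matrix (Fin n) (Fin n) ℝ :=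
  Matrix.of fun i j =>
    fderiv ℝ (fun z => fderiv ℝ g z (EuclideanSpace.single j 1)) x (EuclideanSpace.single i 1)

/-- The data of the problem `min f(x)` subject to `c(x) = 0`, `A x + B y = b`. -/
structure Problem (n m p q : ℕ) where
  f : Vec n → ℝ
  c : Vec n → Vec p
  A : Matrix (Fin q) (Fin n) ℝ
  B : Matrix (Fin q) (Fin m) ℝ
  b : Vec q

variable {n m p q : ℕ}

namespace Problem

/-- The residual `A x + B y - b` of the linear constraints. -/
def residual (P : Problem n m p q) (x : Vec n) (y : Vec m) : Vec q :=
  mulV P.A x + mulV P.B y - P.b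

/-- The KKT conditions of the problem at `(x, y, μ, lam)`. -/
structure IsKKT (P : Problem n m p q) (x : Vec n) (y : Vec m) (μ : Vec p) (lam : Vec q) :
    Prop where
  stationary_x :
    gradient P.f x + mulV (jacobian P.c x).transpose μ + mulV P.A.transpose lam = 0
  stationary_y : mulV P.B.transpose lam = 0
  feasible_c : P.c x = 0
  feasible_lin : mulV P.A x + mulV P.B y = P.b

/-- The matrix `C = [∇c(x)ᵀ 0; A B]` of the constraint gradients. -/
def constraintJacobian (P : Problem n m p q) (x : Vec n) :
    Matrix (Fin p ⊕ Fin q) (Fin n ⊕ Fin m) ℝ :=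
  Matrix.fromBlocks (jacobian P.c x) 0 P.A P.B

/-- `H_xx(x, μ) = ∇²f(x) + ∑ⱼ μⱼ ∇²cⱼ(x)`. -/
def lagrangianHessian (P : Problem n m p q) (x : Vec n) (μ : Vec p) :
    Matrix (Fin n) (Fin n) ℝ :=
  hessian P.f x + ∑ j, μ j • hessian (fun z => P.c z j) x

/-- Regularity of the problem at `(x, y, μ, lam)`: smoothness, the KKT conditions, the linear
independence constraint qualification and the second-order sufficient condition. -/
structure IsRegularAt (P : Problem n m p q) (x : Vec n) (y : Vec m) (μ : Vec p) (lam : Vec q) :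
    Prop where
  contDiff_f : ContDiff ℝ 1 P.f
  contDiff_c : ContDiff ℝ 1 P.c
  kkt : P.IsKKT x y μ lam
  contDiff_two : ∃ U : Set (Vec n), IsOpen U ∧ x ∈ U ∧ ContDiffOn ℝ 2 P.f U ∧
    ContDiffOn ℝ 2 P.c U
  licq : LinearIndependent ℝ (P.constraintJacobian x).row
  second_order : ∀ z : Fin n ⊕ Fin m → ℝ, z ≠ 0 → (P.constraintJacobian x).mulVec z = 0 →
    0 < dotProduct z ((Matrix.fromBlocks (P.lagrangianHessian x μ) 0 0 0).mulVec z)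

/-- The augmented linear-constraint term `lamᵀ(A x + B y - b) + (ρ/2)‖A x + B y - b‖²`. -/
def penalty (P : Problem n m p q) (ρ : ℝ) (lam : Vec q) (x : Vec n) (y : Vec m) : ℝ :=
  inner ℝ lam (P.residual x y) + ρ / 2 * ‖P.residual x y‖ ^ 2

/-- The ADMM iteration (run without its stopping test) with penalty parameter `ρ`. The entries
`x 0` and `μ 0` play no role. In every iteration `x (k+1)` is a local minimizer of the subproblem
`min f(x) + lam_kᵀ(A x + B y_k - b) + (ρ/2)‖A x + B y_k - b‖²` subject to `c(x) = 0`, and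
`(x (k+1), μ (k+1))` is a KKT point of that subproblem. -/
structure IsADMMRun (P : Problem n m p q) (ρ : ℝ) (x : ℕ → Vec n) (y : ℕ → Vec m)
    (μ : ℕ → Vec p) (lam : ℕ → Vec q) : Prop where
  rho_pos : 0 < ρ
  init : mulV P.B.transpose (lam 0) = 0
  sub_feasible : ∀ k, P.c (x (k + 1)) = 0
  sub_localMin : ∀ k,
    IsLocalMinOn (fun z => P.f z + P.penalty ρ (lam k) z (y k)) {z | P.c z = 0} (x (k + 1))
  sub_stationary : ∀ k,
    gradient P.f (x (k + 1)) + mulV (jacobian P.c (x (k + 1))).transpose (μ (k + 1)) +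
      mulV P.A.transpose (lam k + ρ • P.residual (x (k + 1)) (y k)) = 0
  y_update : ∀ k, IsMinOn (fun w => P.penalty ρ (lam k) (x (k + 1)) w) Set.univ (y (k + 1))
  lam_update : ∀ k, lam (k + 1) = lam k + ρ • P.residual (x (k + 1)) (y (k + 1))

end Problem

/-- The Euclidean distance between `(x, y, μ, lam)` and `(x', y', μ', lam')` in the product. -/
def dist4 (x x' : Vec n) (y y' : Vec m) (μ μ' : Vec p) (lam lam' : Vec q) : ℝ :=
  Real.sqrt (‖x - x'‖ ^ 2 + ‖y - y'‖ ^ 2 + ‖μ - μ'‖ ^ 2 + ‖lam - lam'‖ ^ 2)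

end NonconvexADMM

end

open Filter Topology Asymptotics

namespace NonconvexADMM

/-! ### Second-order expansions -/

/-! The proof tracks `V k = ρ⁻¹‖lam k - lams‖² + ρ‖B(y k - ys)‖²`. By `lyapunov_identity`, its
decrease in one step is `ρ‖q‖² + ρ‖B(y k - y (k+1))‖²` plus twice the inner product of `x - xs` with
the change in `∇f + ∇c μ`. For convex problems that inner product would be nonnegative. Here
`exists_local_monotone` bounds it below by `-σ‖q‖²` near the KKT point: up to `o(‖x - xs‖²)` it is
the Lagrangian Hessian form, which becomes coercive once `σ` times the squared linearized
constraints is added (Finsler), and along `c = 0` the linearization of `c` is of second order. Since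
`σ` and `ε` do not involve `ρ`, any `ρ > 4σ` absorbs the loss, and telescoping gives the limit. -/

lemma dotProduct_hessian_mulVec {n : ℕ} {g : Vec n → ℝ} {a : Vec n}
    (hg : DifferentiableAt ℝ (fderiv ℝ g) a) (d : Vec n) :
    dotProduct d.ofLp ((hessian g a).mulVec d.ofLp) = fderiv ℝ (fderiv ℝ g) a d d := by
  have hent (i j : Fin n) : hessian g a i j =
      fderiv ℝ (fderiv ℝ g) a (EuclideanSpace.single i 1) (EuclideanSpace.single j 1) := by
    have h := (hg.hasFDerivAt.clm_apply
      (hasFDerivAt_const (EuclideanSpace.single j (1 : ℝ)) a)).fderiv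
    simp only [hessian, Matrix.of_apply]
    rw [h]
    simp
  have hd : d = ∑ i, d i • EuclideanSpace.single i (1 : ℝ) := by
    ext j
    simp [Finset.sum_apply, Pi.single_apply]
  conv_rhs => rw [hd]
  simp only [map_sum, map_smul, _root_.sum_apply, _root_.smul_apply,
    smul_eq_mul, dotProduct, Matrix.mulVec, hent, Finset.mul_sum]
  rw [Finset.sum_comm]
  exact Finset.sum_congr rfl fun i _ => Finset.sum_congr rfl fun j _ => by ring

/-- First-order expansion of the derivative of a `C²` function, tested against `x - a`. -/
lemma isLittleO_fderiv_sub_hessian {n : ℕ} {g : Vec n → ℝ} {a : Vec n}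
    (hg : ContDiffAt ℝ 2 g a) :
    (fun x => (fderiv ℝ g x - fderiv ℝ g a) (x - a) -
      dotProduct (x - a).ofLp ((hessian g a).mulVec (x - a).ofLp))
      =o[𝓝 a] fun x => ‖x - a‖ ^ 2 := by
  have hd : DifferentiableAt ℝ (fderiv ℝ g) a :=
    (hg.fderiv_right (m := 1) (by norm_num)).differentiableAt one_ne_zero
  rw [isLittleO_iff]
  intro r hr
  filter_upwards [hd.hasFDerivAt.isLittleO.def hr] with x hx
  rw [dotProduct_hessian_mulVec hd, ← _root_.sub_apply]
  refine (ContinuousLinearMap.le_opNorm _ _).trans ?_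
  rw [norm_pow, norm_norm, sq, ← mul_assoc]
  gcongr

/-- On a level set of a `C²` function, secants are tangent up to second order. -/
lemma exists_abs_fderiv_le_of_eq {n : ℕ} {g : Vec n → ℝ} {a : Vec n}
    (hg : ContDiffAt ℝ 2 g a) :
    ∃ K : ℝ, ∀ᶠ x in 𝓝 a, g x = g a →
      |fderiv ℝ g x (x - a)| ≤ K * ‖x - a‖ ^ 2 ∧ |fderiv ℝ g a (x - a)| ≤ K * ‖x - a‖ ^ 2 := by
  obtain ⟨K, t, ht, hK⟩ :=
    (hg.fderiv_right (m := 1) (by norm_num)).exists_lipschitzOnWith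
  have hdiff : ∀ᶠ x in 𝓝 a, DifferentiableAt ℝ g x :=
    (hg.eventually (by simp)).mono fun x hx => hx.differentiableAt two_ne_zero
  obtain ⟨r, hr, hball⟩ := Metric.mem_nhds_iff.1 (inter_mem ht hdiff)
  refine ⟨K, ?_⟩
  filter_upwards [Metric.ball_mem_nhds a hr] with x hx hgx
  have hseg : segment ℝ a x ⊆ Metric.ball a r :=
    (convex_ball a r).segment_subset (Metric.mem_ball_self hr) hx
  -- Mean value inequality for `g` minus its linearization at `z`: the increment of `g` from `a` to
  -- `x` vanishes, leaving only the Lipschitz error of the derivative. Both endpoints are then taken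
  -- as `z`.
  have key (z : Vec n) (hz : z ∈ segment ℝ a x) :
      |fderiv ℝ g z (x - a)| ≤ K * ‖x - a‖ ^ 2 := by
    have h := (convex_segment a x).norm_image_sub_le_of_norm_fderiv_le' (f := g)
      (φ := fderiv ℝ g z) (C := K * ‖x - a‖) (𝕜 := ℝ)
      (fun w hw => (hball (hseg hw)).2)
      (fun w hw => by
        refine (hK.norm_sub_le (hball (hseg hw)).1 (hball (hseg hz)).1).trans ?_
        gcongr
        rw [segment_eq_image'] at hw hz
        obtain ⟨s, hs, rfl⟩ := hw
        obtain ⟨u, hu, rfl⟩ := hz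
        simp only [add_sub_add_left_eq_sub, ← sub_smul, norm_smul, Real.norm_eq_abs]
        refine mul_le_of_le_one_left (norm_nonneg _) ?_
        rw [abs_le]
        constructor <;> linarith [hs.1, hs.2, hu.1, hu.2])
      (left_mem_segment ℝ a x) (right_mem_segment ℝ a x)
    rw [hgx, sub_self, zero_sub, norm_neg, Real.norm_eq_abs, mul_assoc, ← sq] at h
    exact h
  exact ⟨key x (right_mem_segment ℝ a x), key a (left_mem_segment ℝ a x)⟩

/-! ### Finsler's lemma for homogeneous functions -/

/-- If `h` and `g` are continuous and homogeneous of degree two, `g ≥ 0`, and `h` is positive at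
the nonzero zeros of `g`, then `h + σ g` is coercive for some `σ > 0`. -/
lemma exists_coercive_add_mul {V : Type*} [NormedAddCommGroup V] [NormedSpace ℝ V]
    [FiniteDimensional ℝ V] {h g : V → ℝ} (hh : Continuous h) (hg : Continuous g)
    (hh2 : ∀ (t : ℝ) z, h (t • z) = t ^ 2 * h z) (hg2 : ∀ (t : ℝ) z, g (t • z) = t ^ 2 * g z)
    (hg0 : ∀ z, 0 ≤ g z) (hpos : ∀ z, z ≠ 0 → g z = 0 → 0 < h z) :
    ∃ σ > (0 : ℝ), ∃ r > (0 : ℝ), ∀ z, r * ‖z‖ ^ 2 ≤ h z + σ * g z := by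
  have hS : IsCompact (Metric.sphere (0 : V) 1) := isCompact_sphere 0 1
  have hne {z : V} (hz : z ∈ Metric.sphere (0 : V) 1) : z ≠ 0 :=
    ne_zero_of_mem_unit_sphere ⟨z, hz⟩
  obtain ⟨M, hM⟩ := hS.exists_bound_of_continuousOn hh.continuousOn
  -- The part of the sphere where `h ≤ 0` is compact and `g` has no zero on it.
  obtain ⟨g0, hg0pos, hg0le⟩ : ∃ g0 > (0 : ℝ), ∀ z ∈ Metric.sphere (0 : V) 1, h z ≤ 0 →
      g0 ≤ g z := by
    have hK : IsCompact (Metric.sphere (0 : V) 1 ∩ {z | h z ≤ 0}) :=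
      hS.inter_right (isClosed_le hh continuous_const)
    obtain ⟨g0, h0, hle⟩ := hK.exists_forall_le' (f := g) (a := 0) hg.continuousOn
      fun z hz => (hg0 z).lt_of_ne' fun h0 => (hpos z (hne hz.1) h0).not_ge hz.2
    exact ⟨g0, h0, fun z hz hhz => hle z ⟨hz, hhz⟩⟩
  -- Chosen so that `σ g ≥ |M| + 1` outweighs `h ≥ -|M|` wherever `h ≤ 0`.
  set σ := (|M| + 1) / g0 with hσ
  have hσpos : 0 < σ := by positivity
  obtain ⟨r, hr, hle⟩ := hS.exists_forall_le' (f := fun z => h z + σ * g z) (a := 0)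
    (hh.add (continuous_const.mul hg)).continuousOn fun z hz => by
      by_cases hz0 : h z ≤ 0
      · have h1 : -|M| ≤ h z := by
          have := hM z hz
          rw [Real.norm_eq_abs] at this
          linarith [neg_abs_le (h z), le_abs_self M]
        have h2 : |M| + 1 ≤ σ * g z := by
          calc |M| + 1 = σ * g0 := by rw [hσ]; field_simp
            _ ≤ σ * g z := by gcongr; exact hg0le z hz hz0
        linarith
      · have := mul_nonneg hσpos.le (hg0 z)
        linarith
  refine ⟨σ, hσpos, r, hr, fun z => ?_⟩
  rcases eq_or_ne z 0 with rfl | hz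
  · have h1 := hh2 0 0
    have h2 := hg2 0 0
    simp only [zero_smul] at h1 h2
    rw [h1, h2]
    simp
  · have hz' : 0 < ‖z‖ := norm_pos_iff.2 hz
    have hmem : ‖z‖⁻¹ • z ∈ Metric.sphere (0 : V) 1 := by
      simp [norm_smul, hz'.ne']
    have := hle _ hmem
    simp only [hh2, hg2] at this
    have h3 := mul_le_mul_of_nonneg_left this (sq_nonneg ‖z‖)
    have h4 : ‖z‖ ^ 2 * (‖z‖⁻¹ ^ 2 * h z + σ * (‖z‖⁻¹ ^ 2 * g z)) = h z + σ * g z := by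
      field_simp
    linarith

/-! ### Matrix-vector products -/

lemma mulV_add {a b : ℕ} (M : Matrix (Fin a) (Fin b) ℝ) (v w : Vec b) :
    mulV M (v + w) = mulV M v + mulV M w := by
  ext i; simp [mulV, Matrix.mulVec_add]

lemma mulV_sub {a b : ℕ} (M : Matrix (Fin a) (Fin b) ℝ) (v w : Vec b) :
    mulV M (v - w) = mulV M v - mulV M w := by
  ext i; simp [mulV, Matrix.mulVec_sub]

lemma mulV_smul {a b : ℕ} (M : Matrix (Fin a) (Fin b) ℝ) (t : ℝ) (v : Vec b) :
    mulV M (t • v) = t • mulV M v := by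
  ext i; simp [mulV, Matrix.mulVec_smul]

lemma continuous_mulV {a b : ℕ} (M : Matrix (Fin a) (Fin b) ℝ) : Continuous (mulV M) := by
  unfold mulV
  fun_prop

lemma inner_mulV_transpose {a b : ℕ} (M : Matrix (Fin a) (Fin b) ℝ) (v : Vec b) (w : Vec a) :
    inner ℝ v (mulV M.transpose w) = inner ℝ (mulV M v) w := by
  simp only [mulV, EuclideanSpace.inner_eq_star_dotProduct, star_trivial]
  rw [Matrix.mulVec_transpose, ← Matrix.dotProduct_mulVec]

lemma mulV_jacobian_apply {n p : ℕ} (c : Vec n → Vec p) (x v : Vec n) (j : Fin p) :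
    mulV (jacobian c x) v j = fderiv ℝ (fun z => c z j) x v := by
  rw [← inner_gradient_left, EuclideanSpace.inner_eq_star_dotProduct, dotProduct_comm]
  rfl

lemma inner_mulV_jacobian_transpose {n p : ℕ} (c : Vec n → Vec p) (x v : Vec n) (w : Vec p) :
    inner ℝ v (mulV (jacobian c x).transpose w) =
      ∑ j, w j * fderiv ℝ (fun z => c z j) x v := by
  rw [inner_mulV_transpose, PiLp.inner_apply]
  exact Finset.sum_congr rfl fun j _ => by rw [mulV_jacobian_apply]; simp

namespace Problem

variable {n m p q : ℕ} {P : Problem n m p q}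

/-! ### Local monotonicity of the reduced gradient -/

lemma dotProduct_lagrangianHessian (P : Problem n m p q) (x : Vec n) (μ : Vec p)
    (d : Fin n → ℝ) :
    dotProduct d ((P.lagrangianHessian x μ).mulVec d) =
      dotProduct d ((hessian P.f x).mulVec d) +
        ∑ j, μ j * dotProduct d ((hessian (fun z => P.c z j) x).mulVec d) := by
  simp only [lagrangianHessian, Matrix.add_mulVec, dotProduct_add, Matrix.sum_mulVec,
    dotProduct_sum, Matrix.smul_mulVec, dotProduct_smul, smul_eq_mul]

/-- The second-order sufficient condition makes an augmented quadratic form coercive. -/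
lemma IsRegularAt.exists_coercive {xs : Vec n} {ys : Vec m} {μs : Vec p} {lams : Vec q}
    (h : P.IsRegularAt xs ys μs lams) :
    ∃ σ > (0 : ℝ), ∃ r > (0 : ℝ), ∀ (d : Vec n) (w : Vec m), r * ‖d‖ ^ 2 ≤
      dotProduct d.ofLp ((P.lagrangianHessian xs μs).mulVec d.ofLp) +
        σ * (‖mulV (jacobian P.c xs) d‖ ^ 2 + ‖mulV P.A d + mulV P.B w‖ ^ 2) := by
  -- Coercivity holds in the pair `(d, w)`, although the Hessian form ignores `w`; only the `d` part
  -- is kept.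
  obtain ⟨σ, hσ, r, hr, hle⟩ := exists_coercive_add_mul (V := Vec n × Vec m)
    (h := fun z => dotProduct z.1.ofLp ((P.lagrangianHessian xs μs).mulVec z.1.ofLp))
    (g := fun z => ‖mulV (jacobian P.c xs) z.1‖ ^ 2 + ‖mulV P.A z.1 + mulV P.B z.2‖ ^ 2)
    (by fun_prop)
    ((((continuous_mulV _).comp continuous_fst).norm.pow 2).add
      ((((continuous_mulV _).comp continuous_fst).add
        ((continuous_mulV _).comp continuous_snd)).norm.pow 2))
    (fun t z => by
      simp only [Prod.smul_fst, WithLp.ofLp_smul, Matrix.mulVec_smul, dotProduct_smul,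
        smul_dotProduct, smul_eq_mul]
      ring)
    (fun t z => by
      simp only [Prod.smul_fst, Prod.smul_snd, mulV_smul, ← smul_add, norm_smul, mul_pow,
        Real.norm_eq_abs, sq_abs]
      ring)
    (fun z => by positivity)
    (fun z hz hgz => by
      have h1 : mulV (jacobian P.c xs) z.1 = 0 := by
        have : ‖mulV (jacobian P.c xs) z.1‖ ^ 2 = 0 := by
          nlinarith [sq_nonneg ‖mulV (jacobian P.c xs) z.1‖,
            sq_nonneg ‖mulV P.A z.1 + mulV P.B z.2‖]
        simpa using this
      have h2 : mulV P.A z.1 + mulV P.B z.2 = 0 := by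
        rw [h1] at hgz
        simpa using hgz
      have h1' := congrArg WithLp.ofLp h1
      have h2' := congrArg WithLp.ofLp h2
      simp only [mulV, WithLp.ofLp_add, WithLp.ofLp_zero] at h1' h2'
      have := h.second_order (Sum.elim z.1.ofLp z.2.ofLp)
        (fun h0 => hz (by
          ext i
          · exact congrFun h0 (Sum.inl i)
          · exact congrFun h0 (Sum.inr i)))
        (by
          rw [constraintJacobian, Matrix.fromBlocks_mulVec]
          simp only [Sum.elim_comp_inl, Sum.elim_comp_inr, Matrix.zero_mulVec, add_zero]
          rw [h1', h2']
          ext (i | i) <;> rfl)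
      simpa [Matrix.fromBlocks_mulVec, dotProduct] using this)
  refine ⟨σ, hσ, r, hr, fun d w => le_trans ?_ (hle (d, w))⟩
  gcongr
  exact norm_fst_le (d, w)

/-- Near a regular point, the `x`-gradient of the Lagrangian without its linear-constraint term is
monotone along feasible points, up to a multiple of the squared linear residual. -/
lemma IsRegularAt.exists_local_monotone {xs : Vec n} {ys : Vec m} {μs : Vec p} {lams : Vec q}
    (h : P.IsRegularAt xs ys μs lams) :
    ∃ σ > (0 : ℝ), ∃ ε > (0 : ℝ), ∀ (x : Vec n) (y : Vec m) (μ : Vec p),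
      ‖x - xs‖ < ε → ‖μ - μs‖ < ε → P.c x = 0 →
      -(σ * ‖P.residual x y‖ ^ 2) ≤
        inner ℝ (x - xs) ((gradient P.f x + mulV (jacobian P.c x).transpose μ) -
          (gradient P.f xs + mulV (jacobian P.c xs).transpose μs)) := by
  obtain ⟨U, hU, hxU, hfU, hcU⟩ := h.contDiff_two
  have hf : ContDiffAt ℝ 2 P.f xs := hfU.contDiffAt (hU.mem_nhds hxU)
  have hc (j : Fin p) : ContDiffAt ℝ 2 (fun z => P.c z j) xs :=
    (contDiffAt_euclidean.1 (hcU.contDiffAt (hU.mem_nhds hxU))) j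
  obtain ⟨σ, hσ, r, hr, hcoer⟩ := h.exists_coercive
  -- Restricting to feasible points makes `xs` and `x` lie on a common level set of each `c j`, so
  -- both derivatives along `x - xs` are `O(‖x - xs‖²)`.
  let l : Filter (Vec n × Vec p) := (𝓝 xs ×ˢ 𝓝 μs) ⊓ 𝓟 {z | P.c z.1 = 0}
  have hl1 : Tendsto Prod.fst l (𝓝 xs) := tendsto_fst.mono_left inf_le_left
  have hl2 : Tendsto Prod.snd l (𝓝 μs) := tendsto_snd.mono_left inf_le_left
  have hlc : ∀ᶠ z in l, P.c z.1 = 0 := mem_inf_of_right (mem_principal_self _)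
  have hd0 : Tendsto (fun z : Vec n × Vec p => ‖z.1 - xs‖) l (𝓝 0) := by
    simpa using (hl1.sub_const xs).norm
  have htan (j : Fin p) :
      (fun z : Vec n × Vec p => fderiv ℝ (fun w => P.c w j) z.1 (z.1 - xs))
        =O[l] (fun z => ‖z.1 - xs‖ ^ 2) ∧
      (fun z : Vec n × Vec p => fderiv ℝ (fun w => P.c w j) xs (z.1 - xs))
        =O[l] (fun z => ‖z.1 - xs‖ ^ 2) := by
    obtain ⟨K, hK⟩ := exists_abs_fderiv_le_of_eq (hc j)
    have hev := (hl1.eventually hK).and hlc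
    constructor <;> refine IsBigO.of_bound K (hev.mono fun z hz => ?_) <;>
      rw [Real.norm_eq_abs, norm_pow, norm_norm] <;>
      have := hz.1 (by rw [hz.2, h.kkt.feasible_c])
    exacts [this.1, this.2]
  have hmul (j : Fin p) :
      (fun z : Vec n × Vec p => (z.2 j - μs j) * fderiv ℝ (fun w => P.c w j) z.1 (z.1 - xs))
        =o[l] fun z => ‖z.1 - xs‖ ^ 2 := by
    have h0 : Tendsto (fun z : Vec n × Vec p => z.2 j - μs j) l (𝓝 0) := by
      have : Continuous fun v : Vec p => v j - μs j := by fun_prop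
      simpa [Function.comp_def] using (this.tendsto μs).comp hl2
    simpa using ((isLittleO_one_iff ℝ).2 h0).mul_isBigO (htan j).1
  have hJ : (fun z : Vec n × Vec p => ‖mulV (jacobian P.c xs) (z.1 - xs)‖ ^ 2)
      =o[l] fun z => ‖z.1 - xs‖ ^ 2 := by
    simp only [fun v : Vec p => EuclideanSpace.real_norm_sq_eq v, mulV_jacobian_apply]
    refine IsLittleO.fun_sum fun j _ => ?_
    have h0 : (fun z : Vec n × Vec p => fderiv ℝ (fun w => P.c w j) xs (z.1 - xs))
        =o[l] fun _ => (1 : ℝ) := by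
      refine (htan j).2.trans_isLittleO ((isLittleO_one_iff ℝ).2 ?_)
      simpa using hd0.pow 2
    simpa [sq] using h0.mul_isBigO (htan j).2
  -- The total error in replacing the inner product by the coercive form, with the linearized `c`
  -- term removed; it is then bounded by the coercivity constant `r` itself.
  have hsum := (((isLittleO_fderiv_sub_hessian hf).comp_tendsto hl1).add
    (IsLittleO.fun_sum (s := Finset.univ) fun j _ =>
      ((isLittleO_fderiv_sub_hessian (hc j)).comp_tendsto hl1).const_mul_left (μs j))).add
    ((IsLittleO.fun_sum (s := Finset.univ) fun j _ => hmul j).sub (hJ.const_mul_left σ))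
  have hev := hsum.def hr
  obtain ⟨ε, hε, hball⟩ := Metric.mem_nhds_iff.1
    ((nhds_prod_eq (x := xs) (y := μs)).symm ▸ mem_inf_principal.1 hev)
  refine ⟨σ, hσ, ε, hε, fun x y μ hx hμ hcx => ?_⟩
  have hmem := @hball (x, μ) (by
    rw [← ball_prod_same]
    exact ⟨mem_ball_iff_norm.2 hx, mem_ball_iff_norm.2 hμ⟩) hcx
  -- No closeness of `y` to `ys` is needed, because `hcoer` holds for every `w`.
  have hres : P.residual x y = mulV P.A (x - xs) + mulV P.B (y - ys) := by
    rw [residual, mulV_sub, mulV_sub, ← h.kkt.feasible_lin]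
    abel
  have hco := hcoer (x - xs) (y - ys)
  rw [← hres, dotProduct_lagrangianHessian] at hco
  simp only [Set.mem_ofPred_eq, Function.comp_apply, norm_pow, Real.norm_eq_abs, abs_norm,
    _root_.sub_apply] at hmem
  have hlow := (abs_le.1 hmem).1
  rw [inner_sub_right, inner_add_right, inner_add_right, inner_mulV_jacobian_transpose,
    inner_mulV_jacobian_transpose, inner_gradient_right, inner_gradient_right]
  simp only [conj_trivial]
  simp only [mul_sub, sub_mul, Finset.sum_sub_distrib] at hlow
  linarith

/-! ### The Lyapunov decrease of ADMM -/

/-- The optimality condition of the unconstrained quadratic `y`-subproblem. -/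
lemma mulV_transpose_eq_zero_of_isMinOn_penalty {ρ : ℝ} {lam : Vec q} {x : Vec n} {y : Vec m}
    (hmin : IsMinOn (fun w => P.penalty ρ lam x w) Set.univ y) :
    mulV P.B.transpose (lam + ρ • P.residual x y) = 0 := by
  set v := mulV P.B.transpose (lam + ρ • P.residual x y) with hv
  -- Here `v` is the gradient of the penalty in `y`; the minimizer is compared with points on the
  -- line through it in direction `v`.
  have hquad (t : ℝ) : 0 ≤ t * ‖v‖ ^ 2 + t ^ 2 * (ρ / 2 * ‖mulV P.B v‖ ^ 2) := by
    have h := hmin (Set.mem_univ (y + t • v))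
    have hres : P.residual x (y + t • v) = P.residual x y + t • mulV P.B v := by
      simp only [residual, mulV_add, mulV_smul]
      abel
    have hin : ‖v‖ ^ 2 = inner ℝ lam (mulV P.B v) +
        ρ * inner ℝ (P.residual x y) (mulV P.B v) := by
      rw [← real_inner_self_eq_norm_sq]
      nth_rewrite 2 [hv]
      rw [inner_mulV_transpose, inner_add_right, real_inner_smul_right,
        real_inner_comm lam, real_inner_comm (P.residual x y)]
    simp only [Set.mem_ofPred_eq, penalty, hres, inner_add_right, real_inner_smul_right,
      norm_add_sq_real, norm_smul, mul_pow, Real.norm_eq_abs, sq_abs] at h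
    rw [hin]
    linarith
  by_contra hne
  have hpos : 0 < ‖v‖ ^ 2 := by positivity
  set K := |ρ / 2 * ‖mulV P.B v‖ ^ 2| + 1 with hK
  have hK0 : 0 < K := by positivity
  have hKle : ρ / 2 * ‖mulV P.B v‖ ^ 2 ≤ K := (le_abs_self _).trans (by linarith)
  -- This step minimizes the upper bound `t‖v‖² + t²K`, making it negative.
  have h := hquad (-(‖v‖ ^ 2 / (2 * K)))
  have h2 : (‖v‖ ^ 2 / (2 * K)) ^ 2 * (ρ / 2 * ‖mulV P.B v‖ ^ 2) ≤
      (‖v‖ ^ 2 / (2 * K)) ^ 2 * K := by gcongr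
  have h3 : (‖v‖ ^ 2 / (2 * K)) ^ 2 * K = ‖v‖ ^ 2 / (2 * K) * ‖v‖ ^ 2 / 2 := by
    field_simp
  have h4 : 0 < ‖v‖ ^ 2 / (2 * K) * ‖v‖ ^ 2 := by positivity
  rw [neg_sq] at h
  linarith

variable {ρ : ℝ} {x : ℕ → Vec n} {y : ℕ → Vec m} {μ : ℕ → Vec p} {lam : ℕ → Vec q}

/-- After the first index, `lam` is exactly the multiplier in the optimality condition of the
`y`-update. -/
lemma IsADMMRun.mulV_transpose_lam (h : P.IsADMMRun ρ x y μ lam) (k : ℕ) :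
    mulV P.B.transpose (lam k) = 0 := by
  cases k with
  | zero => exact h.init
  | succ k =>
    rw [h.lam_update k]
    exact mulV_transpose_eq_zero_of_isMinOn_penalty (h.y_update k)

/-- `ρ q` is a difference of two multipliers in the kernel of `Bᵀ`; hence the residual is orthogonal
to the range of `B`. -/
lemma IsADMMRun.mulV_transpose_residual (h : P.IsADMMRun ρ x y μ lam) (k : ℕ) :
    mulV P.B.transpose (P.residual (x (k + 1)) (y (k + 1))) = 0 := by
  have h1 := h.mulV_transpose_lam (k + 1)
  rw [h.lam_update k, mulV_add, mulV_smul, h.mulV_transpose_lam k, zero_add] at h1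
  exact (smul_eq_zero.1 h1).resolve_left h.rho_pos.ne'

/-- The change of the Lyapunov function `ρ⁻¹ ‖lam - lams‖² + ρ ‖B (y - ys)‖²` in one step. -/
lemma IsADMMRun.lyapunov_identity (h : P.IsADMMRun ρ x y μ lam) {xs : Vec n} {ys : Vec m}
    {μs : Vec p} {lams : Vec q} (hs : P.IsKKT xs ys μs lams) (k : ℕ) :
    2 * inner ℝ (x (k + 1) - xs)
        ((gradient P.f (x (k + 1)) + mulV (jacobian P.c (x (k + 1))).transpose (μ (k + 1))) -
          (gradient P.f xs + mulV (jacobian P.c xs).transpose μs)) =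
      (ρ⁻¹ * ‖lam k - lams‖ ^ 2 + ρ * ‖mulV P.B (y k - ys)‖ ^ 2) -
      (ρ⁻¹ * ‖lam (k + 1) - lams‖ ^ 2 + ρ * ‖mulV P.B (y (k + 1) - ys)‖ ^ 2) -
      ρ * ‖P.residual (x (k + 1)) (y (k + 1))‖ ^ 2 -
      ρ * ‖mulV P.B (y k - y (k + 1))‖ ^ 2 := by
  set Q := P.residual (x (k + 1)) (y (k + 1)) with hQ
  set u := mulV P.B (y (k + 1) - ys) with hu
  set e := mulV P.B (y k - y (k + 1)) with he
  set L := lam (k + 1) - lams with hL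
  have hρ := h.rho_pos
  have hres : P.residual (x (k + 1)) (y k) = Q + e := by
    rw [hQ, he, residual, residual, mulV_sub]
    abel
  -- The `x`-subproblem sees the old `y k`, so its multiplier differs from `lam (k + 1)` by `ρ • e`.
  have hlam : lam k + ρ • P.residual (x (k + 1)) (y k) = lam (k + 1) + ρ • e := by
    rw [hres, smul_add, ← add_assoc, ← h.lam_update k]
  have hG : (gradient P.f (x (k + 1)) + mulV (jacobian P.c (x (k + 1))).transpose (μ (k + 1))) -
      (gradient P.f xs + mulV (jacobian P.c xs).transpose μs) =
      -mulV P.A.transpose (L + ρ • e) := by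
    have h1 := h.sub_stationary k
    rw [hlam] at h1
    rw [eq_neg_of_add_eq_zero_left h1, eq_neg_of_add_eq_zero_left hs.stationary_x, hL,
      sub_add_eq_add_sub, mulV_sub]
    abel
  have hA : mulV P.A (x (k + 1) - xs) = Q - u := by
    rw [hQ, hu, residual, mulV_sub, mulV_sub, ← hs.feasible_lin]
    abel
  -- These orthogonalities reduce `-2⟨Q - u, L + ρe⟩` to `-2⟨Q, L⟩ + 2ρ⟨u, e⟩`, the cross terms of
  -- the squares `‖L - ρQ‖²` and `‖u + e‖²`.
  have hBL (w : Vec m) : inner ℝ (mulV P.B w) L = 0 := by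
    rw [← inner_mulV_transpose, hL, mulV_sub, h.mulV_transpose_lam, hs.stationary_y, sub_zero,
      inner_zero_right]
  have hBQ (w : Vec m) : inner ℝ Q (mulV P.B w) = 0 := by
    rw [real_inner_comm, ← inner_mulV_transpose, h.mulV_transpose_residual, inner_zero_right]
  have hprev : lam k - lams = L - ρ • Q := by
    rw [hL, h.lam_update k]
    abel
  have hyprev : mulV P.B (y k - ys) = u + e := by
    rw [hu, he, ← mulV_add]
    congr 1
    abel
  rw [hG, inner_neg_right, inner_mulV_transpose, hA, inner_sub_left, inner_add_right,
    inner_add_right, real_inner_smul_right, real_inner_smul_right, he, hBQ, ← he, hu, hBL, ← hu,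
    hprev, hyprev, norm_sub_sq_real, norm_add_sq_real, norm_smul, mul_pow, Real.norm_eq_abs,
    sq_abs, real_inner_smul_right, real_inner_comm L Q]
  field_simp
  ring

end Problem

/-! ### Telescoping and conclusion -/

lemma norm_sub_lt_of_dist4_lt {n m p q : ℕ} {x x' : Vec n} {y y' : Vec m} {μ μ' : Vec p}
    {lam lam' : Vec q} {ε : ℝ} (h : dist4 x x' y y' μ μ' lam lam' < ε) :
    ‖x - x'‖ < ε ∧ ‖μ - μ'‖ < ε := by
  constructor <;> refine (Real.le_sqrt_of_sq_le ?_).trans_lt h <;>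
    linarith [sq_nonneg ‖x - x'‖, sq_nonneg ‖y - y'‖, sq_nonneg ‖μ - μ'‖,
      sq_nonneg ‖lam - lam'‖]

/-- A nonnegative sequence dominated by the decrements of a nonnegative sequence tends to zero. -/
lemma tendsto_zero_of_le_sub {V D : ℕ → ℝ} (hV : ∀ k, 0 ≤ V k) (hD : ∀ k, 0 ≤ D k)
    (hle : ∀ᶠ k in atTop, D k ≤ V k - V (k + 1)) : Tendsto D atTop (𝓝 0) := by
  obtain ⟨N, hN⟩ := eventually_atTop.1 hle
  -- The shift by `N` discards the initial steps, where no decrease is known.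
  have hanti : Antitone fun k => V (k + N) := antitone_nat_of_succ_le fun k => by
    have h1 := hN (k + N) (Nat.le_add_left _ _)
    have h2 := hD (k + N)
    rw [add_right_comm k N 1] at h1
    linarith
  have hlim := tendsto_atTop_ciInf hanti ⟨0, by rintro _ ⟨k, rfl⟩; exact hV _⟩
  have hdiff := hlim.sub (hlim.comp (tendsto_add_atTop_nat 1))
  rw [sub_self] at hdiff
  refine (tendsto_add_atTop_iff_nat N).1
    (squeeze_zero (fun k => hD _) (fun k => ?_) hdiff)
  have h1 := hN (k + N) (Nat.le_add_left _ _)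
  rw [add_right_comm k N 1] at h1
  exact h1

end NonconvexADMM

theorem mainTheorem4 {n m p q : ℕ} (P : NonconvexADMM.Problem n m p q)
    (xs : NonconvexADMM.Vec n) (ys : NonconvexADMM.Vec m) (μs : NonconvexADMM.Vec p)
    (lams : NonconvexADMM.Vec q) (hreg : P.IsRegularAt xs ys μs lams) :
    ∃ ε > (0 : ℝ), ∃ ρs > (0 : ℝ), ∀ ρ > ρs,
      ∀ (x : ℕ → NonconvexADMM.Vec n) (y : ℕ → NonconvexADMM.Vec m)
        (μ : ℕ → NonconvexADMM.Vec p) (lam : ℕ → NonconvexADMM.Vec q),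
        P.IsADMMRun ρ x y μ lam →
        (∀ᶠ k in atTop, NonconvexADMM.dist4 (x (k + 1)) xs (y (k + 1)) ys (μ (k + 1)) μs
          (lam (k + 1)) lams < ε) →
        Tendsto (fun k => ρ * ‖NonconvexADMM.mulV P.B (y k - y (k + 1))‖ ^ 2 +
          ρ / 2 * ‖P.residual (x (k + 1)) (y (k + 1))‖ ^ 2) atTop (𝓝 0) := by
  obtain ⟨σ, hσ, ε, hε, hmono⟩ := hreg.exists_local_monotone
  -- With `ρ > 4σ`, the loss `2σ‖q‖²` costs at most half of `ρ‖q‖²`, which leaves the claimed `ρ/2`.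
  refine ⟨ε, hε, 4 * σ, by positivity, fun ρ hρ x y μ lam hrun hev => ?_⟩
  have hρ0 := hrun.rho_pos
  refine NonconvexADMM.tendsto_zero_of_le_sub
    (V := fun k => ρ⁻¹ * ‖lam k - lams‖ ^ 2 + ρ * ‖NonconvexADMM.mulV P.B (y k - ys)‖ ^ 2)
    (fun k => by positivity) (fun k => by positivity) ?_
  filter_upwards [hev] with k hk
  obtain ⟨hx, hμ⟩ := NonconvexADMM.norm_sub_lt_of_dist4_lt hk
  have h1 := hmono (x (k + 1)) (y (k + 1)) (μ (k + 1)) hx hμ (hrun.sub_feasible k)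
  have h2 := hrun.lyapunov_identity hreg.kkt k
  have h3 := mul_le_mul_of_nonneg_right hρ.le
    (sq_nonneg ‖P.residual (x (k + 1)) (y (k + 1))‖)
  linarith
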